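/- Let $\mu$ be a finite Borel measure on the unit sphere $\mathbb{S}^{d-1}$ of $\mathbb{R}^d$ that is symmetric (invariant under $s\mapsto -s$) and nonzero. Let $\mathfrak{B}_\mu$ be a Gaussian white noise on $\mathbb{H}_d=(0,\infty)\times\mathbb{S}^{d-1}$ with control measure $\mathrm{d}\rho\,\mu(\mathrm{d}s)$, that is, a centered Gaussian process indexed by the bounded Borel subsets of $\mathbb{H}_d$ with $$\mathbb{E}[\mathfrak{B}_\mu(V)\mathfrak{B}_\mu(V')]=\int_{\mathbb{H}_d}\mathbf{1}_{V\cap V'}(\rho,s)\,\mathrm{d}\rho\,\mu(\mathrm{d}s),$$ and let $B_\mu=\{B_\mu(t),\,t\in\mathbb{R}^d\}$ be a separable modification of the field $t\mapsto\mathfrak{B}_\mu(V_t)$, where $V_t=\{(\rho,s)\in\mathbb{H}_d : \rho<\langle s,t\rangle\}$. Here, a field $Y$ is separable if there are a countable dense set $S\subset\mathbb{R}^d$ and a null event off which, for every open $U\subseteq\mathbb{R}^d$ and every closed $F\subseteq\mathbb{R}$, if $Y(t)\in F$ for all $t\in U\cap S$ then $Y(t)\in F$ for all $t\in U$. For a locally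 bounded $f:\mathbb{R}^d\to\mathbb{R}$ and $\alpha>0$, write $f\in C^\alpha(t_0)$ if there are $C>0$ and a polynomial $Q$ of degree less than $\alpha$ such that $|f(t)-Q(t)|\le C\|t-t_0\|^\alpha$ for all $t$ in a neighborhood of $t_0$; the Hölder exponent of $f$ at $t_0$ is $\alpha_f(t_0)=\sup\{\alpha>0 : f\in C^\alpha(t_0)\}\in[0,\infty]$ (with $\sup\emptyset=0$). For $h\in[0,\infty]$ and a nonempty open set $W\subseteq\mathbb{R}^d$, let $d_f(h,W)=\dim_{\rm H}\{t\in W : \alpha_f(t)=h\}$, with the convention $\dim_{\rm H}\emptyset=-\infty$. A random field $Y$ on $\mathbb{R}^d$ with almost surely locally bounded sample paths is homogeneous if there is a deterministic function $d_Y$ on $[0,\infty]$ such that, almost surely, $d_Y(h,W)=d_Y(h)$ for all $h\in[0,\infty]$ and all nonempty open $W$; it is moreover mono-Hölder if the set $\{h\in[0,\infty] : d_Y(h)\ge 0\}$ is a single point. Then the sample paths of $B_\mu$ are almost surely locally bounded, $B_\mu$ is a homogeneous mono-Hölder field, and $$\text{a.s.}\quad \forall t\in\mathbb{R}^d\qquad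 \alpha_{B_\mu}(t)=\tfrac12 .$$ -/

import Mathlib

open MeasureTheory ProbabilityTheory Set Filter Topology
open scoped ENNReal

namespace ChentsovField

/-! ### Pointwise regularity of functions on `ℝ^d` -/

section Regularity

variable {d : ℕ}

/-- `f` is bounded in a neighbourhood of every point. -/
def IsLocallyBounded (f : EuclideanSpace ℝ (Fin d) → ℝ) : Prop :=
  ∀ t₀, ∃ C : ℝ, ∀ᶠ t in 𝓝 t₀, |f t| ≤ C

/-- `f ∈ C^α(t₀)` (meant for `α > 0`): near `t₀`, `f` is approximated by some polynomial of degree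
less than `α` up to an error `C ‖t - t₀‖ ^ α`. -/
def MemHolderAt (f : EuclideanSpace ℝ (Fin d) → ℝ) (α : ℝ) (t₀ : EuclideanSpace ℝ (Fin d)) :
    Prop :=
  ∃ C : ℝ, 0 < C ∧ ∃ Q : MvPolynomial (Fin d) ℝ, (Q.totalDegree : ℝ) < α ∧
    ∀ᶠ t in 𝓝 t₀, |f t - MvPolynomial.eval (fun i => t i) Q| ≤ C * ‖t - t₀‖ ^ α

/-- The Hölder exponent of a (locally bounded) function `f` at `t₀`, with values in `[0, ∞]`:
the supremum of all `α > 0` such that `f ∈ C^α(t₀)`, which is `0` if there is none. -/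
noncomputable def holderExponent (f : EuclideanSpace ℝ (Fin d) → ℝ)
    (t₀ : EuclideanSpace ℝ (Fin d)) : ℝ≥0∞ :=
  sSup {a : ℝ≥0∞ | ∃ α : ℝ, 0 < α ∧ MemHolderAt f α t₀ ∧ a = ENNReal.ofReal α}

/-- The iso-Hölder set of `f` for the value `h`. -/
def isoHolderSet (f : EuclideanSpace ℝ (Fin d) → ℝ) (h : ℝ≥0∞) :
    Set (EuclideanSpace ℝ (Fin d)) :=
  {t | holderExponent f t = h}

open Classical in
/-- Hausdorff dimension with the convention that the empty set has dimension `-∞` (that is, `⊥`). -/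
noncomputable def hausdorffDim (s : Set (EuclideanSpace ℝ (Fin d))) : WithBot ℝ≥0∞ :=
  if s = ∅ then ⊥ else ((dimH s : ℝ≥0∞) : WithBot ℝ≥0∞)

/-- The local spectrum of singularities `d_f(h, W)`. -/
noncomputable def localSpectrum (f : EuclideanSpace ℝ (Fin d) → ℝ) (h : ℝ≥0∞)
    (W : Set (EuclideanSpace ℝ (Fin d))) : WithBot ℝ≥0∞ :=
  hausdorffDim (isoHolderSet f h ∩ W)

end Regularity

/-! ### Random fields -/

section RandomFields

variable {d : ℕ} {Ω : Type*} [MeasurableSpace Ω]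

/-- The deterministic function `D` is the spectrum of singularities of the random field `Y`:
almost surely, the sample path is locally bounded (so that its Hölder exponent makes sense) and
its local spectrum on every nonempty open set is `D`. -/
def HasSpectrum (Y : EuclideanSpace ℝ (Fin d) → Ω → ℝ) (P : Measure Ω)
    (D : ℝ≥0∞ → WithBot ℝ≥0∞) : Prop :=
  ∀ᵐ ω ∂P, IsLocallyBounded (fun t => Y t ω) ∧
    ∀ h : ℝ≥0∞, ∀ W : Set (EuclideanSpace ℝ (Fin d)), IsOpen W → W.Nonempty →
      localSpectrum (fun t => Y t ω) h W = D h

/-- The random field `Y` is homogeneous: its local spectrum is a deterministic function which does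
not depend on the region. -/
def IsHomogeneous (Y : EuclideanSpace ℝ (Fin d) → Ω → ℝ) (P : Measure Ω) : Prop :=
  ∃ D : ℝ≥0∞ → WithBot ℝ≥0∞, HasSpectrum Y P D

/-- The random field `Y` is a homogeneous mono-Hölder field: it is homogeneous and its spectrum is
degenerate, that is, the support `{h | 0 ≤ D h}` of its spectrum `D` is a single point. -/
def IsHomogeneousMonoHolder (Y : EuclideanSpace ℝ (Fin d) → Ω → ℝ) (P : Measure Ω) : Prop :=
  ∃ D : ℝ≥0∞ → WithBot ℝ≥0∞, HasSpectrum Y P D ∧ ∃ h₀ : ℝ≥0∞, {h | 0 ≤ D h} = {h₀}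

/-- The random field `Y` is separable: there is a countable dense set `S` such that, off a null
event, for every open set `U` and every closed set `F`, the path takes its values on `U` in `F` as
soon as it takes its values on `U ∩ S` in `F`. -/
def IsSeparableField (Y : EuclideanSpace ℝ (Fin d) → Ω → ℝ) (P : Measure Ω) : Prop :=
  ∃ S : Set (EuclideanSpace ℝ (Fin d)), S.Countable ∧ Dense S ∧
    ∀ᵐ ω ∂P, ∀ U : Set (EuclideanSpace ℝ (Fin d)), IsOpen U → ∀ F : Set ℝ, IsClosed F →
      (∀ t ∈ U ∩ S, Y t ω ∈ F) → ∀ t ∈ U, Y t ω ∈ F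

end RandomFields

/-! ### The Gaussian field `B_μ` -/

section Chentsov

/-- The unit sphere of `ℝ^d`. -/
abbrev UnitSphere (d : ℕ) : Type := Metric.sphere (0 : EuclideanSpace ℝ (Fin d)) 1

/-- The measure `μ` on the unit sphere is symmetric: invariant under `s ↦ -s`. -/
def IsSymmetricMeasure {d : ℕ} (μ : Measure (UnitSphere d)) : Prop :=
  μ.map (fun s => -s) = μ

/-- The space `(0, ∞) × S^{d-1}` of the hyperplanes of `ℝ^d` that do not contain the origin:
the pair `(ρ, s)` represents the hyperplane `{t | ⟪s, t⟫ = ρ}`. -/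
abbrev Hyperplanes (d : ℕ) : Type := Ioi (0 : ℝ) × UnitSphere d

/-- The measure `dρ ⊗ μ(ds)` on `(0, ∞) × S^{d-1}`, with `dρ` the Lebesgue measure. -/
noncomputable def hyperplaneMeasure {d : ℕ} (μ : Measure (UnitSphere d)) :
    Measure (Hyperplanes d) :=
  (Measure.comap Subtype.val (volume : Measure ℝ)).prod μ

/-- The bounded Borel subsets of `(0, ∞) × S^{d-1}` (equivalently, its Borel subsets that are
relatively compact in `[0, ∞) × S^{d-1}`). -/
def BoundedBorel (d : ℕ) : Type :=
  {V : Set (Hyperplanes d) // MeasurableSet V ∧ Bornology.IsBounded V}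

/-- The set of all hyperplanes that separate `t` from the origin. -/
def sepSet {d : ℕ} (t : EuclideanSpace ℝ (Fin d)) : Set (Hyperplanes d) :=
  {p | (p.1 : ℝ) < inner ℝ (p.2 : EuclideanSpace ℝ (Fin d)) t}

theorem measurableSet_sepSet {d : ℕ} (t : EuclideanSpace ℝ (Fin d)) :
    MeasurableSet (sepSet t) := by
  have h1 : Measurable fun p : Hyperplanes d => (p.1 : ℝ) :=
    measurable_subtype_coe.comp measurable_fst
  have h2 : Measurable fun s : UnitSphere d => inner ℝ (s : EuclideanSpace ℝ (Fin d)) t :=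
    (by fun_prop : Continuous fun s : UnitSphere d =>
      inner ℝ (s : EuclideanSpace ℝ (Fin d)) t).measurable
  exact measurableSet_lt h1 (h2.comp measurable_snd)

theorem isBounded_sepSet {d : ℕ} (t : EuclideanSpace ℝ (Fin d)) :
    Bornology.IsBounded (sepSet t) := by
  have h : Bornology.IsBounded
      ((Subtype.val ⁻¹' Icc (0 : ℝ) ‖t‖ : Set (Ioi (0 : ℝ))) ×ˢ (univ : Set (UnitSphere d))) := by
    refine Bornology.IsBounded.prod ?_ ?_
    · refine Metric.isBounded_iff.2 ⟨‖t‖, fun x hx y hy => ?_⟩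
      have hx' : (x : ℝ) ∈ Icc (0 : ℝ) ‖t‖ := hx
      have hy' : (y : ℝ) ∈ Icc (0 : ℝ) ‖t‖ := hy
      rw [Subtype.dist_eq, Real.dist_eq, abs_le]
      constructor <;> linarith [hx'.1, hx'.2, hy'.1, hy'.2]
    · exact isCompact_univ.isBounded
  refine h.subset fun p hp => ⟨⟨p.1.2.le, ?_⟩, mem_univ _⟩
  have h1 : (p.1 : ℝ) < inner ℝ (p.2 : EuclideanSpace ℝ (Fin d)) t := hp
  have h2 := real_inner_le_norm (p.2 : EuclideanSpace ℝ (Fin d)) t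
  rw [norm_eq_of_mem_sphere, one_mul] at h2
  exact h1.le.trans h2

/-- The set `V_t`, as a bounded Borel subset of `(0, ∞) × S^{d-1}`. -/
def sepBorel {d : ℕ} (t : EuclideanSpace ℝ (Fin d)) : BoundedBorel d :=
  ⟨sepSet t, measurableSet_sepSet t, isBounded_sepSet t⟩

variable {d : ℕ} {Ω : Type*} [MeasurableSpace Ω]

/-- `N` is a Gaussian white noise on `(0, ∞) × S^{d-1}` with control measure `dρ ⊗ μ(ds)`: a
centered Gaussian process indexed by the bounded Borel sets such that
`E[N(V) N(V')] = (dρ ⊗ μ)(V ∩ V')`. -/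
structure IsWhiteNoise (μ : Measure (UnitSphere d)) (N : BoundedBorel d → Ω → ℝ)
    (P : Measure Ω) : Prop where
  gaussian : IsGaussianProcess N P
  centered : ∀ V, ∫ ω, N V ω ∂P = 0
  covariance : ∀ V V', ∫ ω, N V ω * N V' ω ∂P =
    (hyperplaneMeasure μ).real (V.1 ∩ V'.1)

/-- `B` is (a version of) the Chentsov-type field `B_μ`: a separable modification of the field
`t ↦ N(V_t)` where `N` is a Gaussian white noise with control measure `dρ ⊗ μ(ds)`. -/
structure IsChentsovField (μ : Measure (UnitSphere d)) (B : EuclideanSpace ℝ (Fin d) → Ω → ℝ)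
    (P : Measure Ω) : Prop where
  exists_whiteNoise : ∃ N : BoundedBorel d → Ω → ℝ, IsWhiteNoise μ N P ∧
    ∀ t, B t =ᵐ[P] N (sepBorel t)
  separable : IsSeparableField B P

end Chentsov

end ChentsovField

/-! For fixed `s`, the slice of `V_t ∩ V_t'` is an interval of hyperplane distances. Pairing `s`
with `-s` by symmetry turns the covariance into `w t + w t' - w (t - t')`, where `w` is a multiple
of the μ-average of `|⟪s, x⟫|`. Two features of `w` drive everything: it is absolutely homogeneous
of degree one and at most a multiple of the norm, so increments over distance `h` have standard
deviation `O(√h)`; and along every line with `w ≠ 0` the field behaves like Brownian motion, with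
independent increments.

Lower bound on the exponent (`ae_modulus_le`, `eventually_abs_sub_le_of_separable`): for `α < 1/2`,
Gaussian moments and Borel–Cantelli on dyadic grids control all neighbouring grid increments.
Chaining extends this to the countable separating set, and separability to all points at once.

Upper bound (`ae_not_holder`): following Dvoretzky, Erdős and Kakutani, Hölder regularity of order
`β > 1/2` at any single point would force `M` consecutive small increments on every fine grid near
it. By independence this has probability of order `2 ^ (-nM(β - 1/2))`, and a large `M` beats the
number of grid points.

Both bounds hold off a null event that does not depend on the point. The exponent is thus `1/2`
everywhere, and the spectrum follows from the dimension of nonempty open sets. -/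

namespace ChentsovField

variable {d : ℕ}

/-! ### Covariance structure of the field. -/

/-- The function `w` for which the field has covariance `w t + w t' - w (t - t')`. -/
noncomputable def halfVariogram (μ : Measure (UnitSphere d)) (x : EuclideanSpace ℝ (Fin d)) : ℝ :=
  (1 / 4) * ∫ s : UnitSphere d, |inner ℝ (s : EuclideanSpace ℝ (Fin d)) x| ∂μ

theorem abs_inner_le_norm_of_unit (s : UnitSphere d) (x : EuclideanSpace ℝ (Fin d)) :
    |inner ℝ (s : EuclideanSpace ℝ (Fin d)) x| ≤ ‖x‖ := by
  have := abs_real_inner_le_norm (s : EuclideanSpace ℝ (Fin d)) x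
  rwa [norm_eq_of_mem_sphere, one_mul] at this

theorem integrable_of_continuous_sphere (μ : Measure (UnitSphere d)) [IsFiniteMeasure μ]
    {f : UnitSphere d → ℝ} (hf : Continuous f) : Integrable f μ :=
  hf.integrable_of_hasCompactSupport (HasCompactSupport.of_compactSpace f)

theorem halfVariogram_nonneg (μ : Measure (UnitSphere d)) (x : EuclideanSpace ℝ (Fin d)) :
    0 ≤ halfVariogram μ x :=
  mul_nonneg (by norm_num) (integral_nonneg fun _ => abs_nonneg _)

theorem halfVariogram_smul (μ : Measure (UnitSphere d)) (c : ℝ) (x : EuclideanSpace ℝ (Fin d)) :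
    halfVariogram μ (c • x) = |c| * halfVariogram μ x := by
  simp only [halfVariogram, inner_smul_right, abs_mul, integral_const_mul]
  ring

theorem halfVariogram_zero (μ : Measure (UnitSphere d)) :
    halfVariogram μ (0 : EuclideanSpace ℝ (Fin d)) = 0 := by
  simp [halfVariogram]

theorem halfVariogram_le (μ : Measure (UnitSphere d)) [IsFiniteMeasure μ]
    (x : EuclideanSpace ℝ (Fin d)) : halfVariogram μ x ≤ μ.real univ * ‖x‖ := by
  have h : ∫ s : UnitSphere d, |inner ℝ (s : EuclideanSpace ℝ (Fin d)) x| ∂μ ≤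
      ∫ _ : UnitSphere d, ‖x‖ ∂μ :=
    integral_mono (integrable_of_continuous_sphere μ (by fun_prop)) (integrable_const _)
      fun s => abs_inner_le_norm_of_unit s x
  rw [integral_const, smul_eq_mul] at h
  have h0 : 0 ≤ ∫ s : UnitSphere d, |inner ℝ (s : EuclideanSpace ℝ (Fin d)) x| ∂μ :=
    integral_nonneg fun _ => abs_nonneg _
  unfold halfVariogram
  linarith

/-- If all these values vanished, μ-almost every unit vector would have every coordinate zero. The
resulting axis carries the nondegenerate increments in `ae_not_holder`. -/
theorem exists_halfVariogram_pos (μ : Measure (UnitSphere d)) [IsFiniteMeasure μ] (hμ : μ ≠ 0) :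
    ∃ i : Fin d, 0 < halfVariogram μ (EuclideanSpace.single i 1) := by
  by_contra! h
  have h1 : ∀ i : Fin d, ∀ᵐ s : UnitSphere d ∂μ, (s : EuclideanSpace ℝ (Fin d)) i = 0 := by
    intro i
    have h0 := le_antisymm (h i) (halfVariogram_nonneg μ _)
    have h2 : ∫ s : UnitSphere d,
        |inner ℝ (s : EuclideanSpace ℝ (Fin d)) (EuclideanSpace.single i 1)| ∂μ = 0 := by
      simpa [halfVariogram] using h0
    rw [integral_eq_zero_iff_of_nonneg (fun _ => abs_nonneg _)
      (integrable_of_continuous_sphere μ (by fun_prop))] at h2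
    filter_upwards [h2] with s hs
    simpa [EuclideanSpace.inner_single_right] using hs
  have h3 : ∀ᵐ _s : UnitSphere d ∂μ, False := by
    filter_upwards [ae_all_iff.2 h1] with s hs
    have : (s : EuclideanSpace ℝ (Fin d)) = 0 := by ext i; simpa using hs i
    have h4 := norm_eq_of_mem_sphere s
    simp [this] at h4
  exact hμ (by simpa using h3)

theorem comap_val_Ioi_apply {b : ℝ} :
    (Measure.comap (Subtype.val : Ioi (0 : ℝ) → ℝ) volume) {x | (x : ℝ) < b} =
      ENNReal.ofReal (max b 0) := by
  rw [comap_subtype_coe_apply measurableSet_Ioi]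
  have : Subtype.val '' {x : Ioi (0 : ℝ) | (x : ℝ) < b} = Ioo 0 b := by
    ext x; simp [and_comm]
  rw [this, Real.volume_Ioo, sub_zero, ENNReal.ofReal_max]
  simp

instance sigmaFinite_comap_val_Ioi :
    SigmaFinite (Measure.comap (Subtype.val : Ioi (0 : ℝ) → ℝ) volume) := by
  refine SigmaFinite.of_map _ measurable_subtype_coe.aemeasurable ?_
  rw [map_comap_subtype_coe measurableSet_Ioi]
  infer_instance

/-- Fubini: over `s`, the set is the interval of `ρ` from `0` to the smaller of the two inner
products. -/
theorem hyperplaneMeasure_real_inter (μ : Measure (UnitSphere d)) [IsFiniteMeasure μ]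
    (t t' : EuclideanSpace ℝ (Fin d)) :
    (hyperplaneMeasure μ).real (sepSet t ∩ sepSet t') =
      ∫ s : UnitSphere d, max (min (inner ℝ (s : EuclideanSpace ℝ (Fin d)) t)
        (inner ℝ (s : EuclideanSpace ℝ (Fin d)) t')) 0 ∂μ := by
  rw [measureReal_def, hyperplaneMeasure, Measure.prod_apply_symm
    ((measurableSet_sepSet t).inter (measurableSet_sepSet t'))]
  have h : ∀ s : UnitSphere d, (Measure.comap (Subtype.val : Ioi (0 : ℝ) → ℝ) volume)
      ((fun x => (x, s)) ⁻¹' (sepSet t ∩ sepSet t')) =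
      ENNReal.ofReal (max (min (inner ℝ (s : EuclideanSpace ℝ (Fin d)) t)
        (inner ℝ (s : EuclideanSpace ℝ (Fin d)) t')) 0) := by
    intro s
    rw [← comap_val_Ioi_apply]
    congr 1
    ext x
    simp [sepSet]
  simp_rw [h]
  rw [integral_eq_lintegral_of_nonneg_ae (Eventually.of_forall fun _ => by simp)]
  exact (by fun_prop : Continuous fun s : UnitSphere d =>
    max (min (inner ℝ (s : EuclideanSpace ℝ (Fin d)) t)
        (inner ℝ (s : EuclideanSpace ℝ (Fin d)) t')) 0).aestronglyMeasurable

/-- With `a = ⟪s, t⟫` and `b = ⟪s, t'⟫`, the two terms on the left are the contributions of `s` and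
`-s` to the covariance. Only their sum is a combination of absolute values, which is where the
symmetry of μ enters. -/
theorem max_min_add_max_min_neg (a b : ℝ) :
    max (min a b) 0 + max (min (-a) (-b)) 0 = (1 / 2) * (|a| + |b| - |a - b|) := by
  rcases le_total 0 a with ha | ha <;> rcases le_total 0 b with hb | hb <;>
    rcases le_total a b with hab | hab <;>
    simp only [abs_of_nonneg, abs_of_nonpos, ha, hb, sub_nonneg, sub_nonpos, hab, min_eq_left,
      min_eq_right, max_eq_left, max_eq_right, neg_le_neg_iff, neg_nonneg, neg_nonpos] <;> linarith

theorem hyperplaneMeasure_real_inter_eq (μ : Measure (UnitSphere d)) [IsFiniteMeasure μ]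
    (hsymm : IsSymmetricMeasure μ) (t t' : EuclideanSpace ℝ (Fin d)) :
    (hyperplaneMeasure μ).real (sepSet t ∩ sepSet t') =
      halfVariogram μ t + halfVariogram μ t' - halfVariogram μ (t - t') := by
  rw [hyperplaneMeasure_real_inter]
  set f : UnitSphere d → ℝ := fun s => max (min (inner ℝ (s : EuclideanSpace ℝ (Fin d)) t)
    (inner ℝ (s : EuclideanSpace ℝ (Fin d)) t')) 0 with hf
  have hfc : Continuous f := by fun_prop
  have h1 : ∫ s, f s ∂μ = ∫ s, f (-s) ∂μ := by
    conv_lhs => rw [← hsymm]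
    exact integral_map (by fun_prop) hfc.aestronglyMeasurable
  have i1 := integrable_of_continuous_sphere μ hfc
  have i2 := integrable_of_continuous_sphere μ (f := fun s => f (-s)) (by fun_prop)
  have h2 : ∫ s, f s ∂μ + ∫ s, f (-s) ∂μ = (1 / 2) *
      ((∫ s : UnitSphere d, |inner ℝ (s : EuclideanSpace ℝ (Fin d)) t| ∂μ) +
      (∫ s : UnitSphere d, |inner ℝ (s : EuclideanSpace ℝ (Fin d)) t'| ∂μ) -
      ∫ s : UnitSphere d, |inner ℝ (s : EuclideanSpace ℝ (Fin d)) (t - t')| ∂μ) := by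
    rw [← integral_add i1 i2, ← integral_add (integrable_of_continuous_sphere μ (by fun_prop))
      (integrable_of_continuous_sphere μ (by fun_prop)), ← integral_sub
      (integrable_of_continuous_sphere μ (by fun_prop))
      (integrable_of_continuous_sphere μ (by fun_prop)), ← integral_const_mul]
    refine integral_congr_ae (Eventually.of_forall fun s => ?_)
    simp only [hf, inner_sub_right]
    rw [← max_min_add_max_min_neg]
    simp [inner_neg_left]
  unfold halfVariogram
  linarith

variable {Ω : Type*} [MeasurableSpace Ω] {P : Measure Ω}

/-- `X` is a centered Gaussian field with covariance `w t + w t' - w (t - t')`. -/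
structure IsVariogramField (μ : Measure (UnitSphere d)) (X : EuclideanSpace ℝ (Fin d) → Ω → ℝ)
    (P : Measure Ω) : Prop where
  gaussian : IsGaussianProcess X P
  centered : ∀ t, ∫ ω, X t ω ∂P = 0
  cov : ∀ t t', cov[X t, X t'; P] =
    halfVariogram μ t + halfVariogram μ t' - halfVariogram μ (t - t')

theorem IsWhiteNoise.isVariogramField {μ : Measure (UnitSphere d)} [IsFiniteMeasure μ]
    (hsymm : IsSymmetricMeasure μ) {N : BoundedBorel d → Ω → ℝ} (hN : IsWhiteNoise μ N P) :
    IsVariogramField μ (fun t => N (sepBorel t)) P where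
  gaussian := hN.gaussian.comp_right sepBorel
  centered t := hN.centered _
  cov t t' := by
    have : IsProbabilityMeasure P :=
      (hN.gaussian.hasGaussianLaw_eval (sepBorel t)).isProbabilityMeasure
    rw [covariance_eq_sub (hN.gaussian.hasGaussianLaw_eval _).memLp_two
      (hN.gaussian.hasGaussianLaw_eval _).memLp_two, hN.centered, zero_mul, sub_zero,
      ← hyperplaneMeasure_real_inter_eq μ hsymm]
    exact hN.covariance _ _

namespace IsVariogramField

variable {μ : Measure (UnitSphere d)} {X : EuclideanSpace ℝ (Fin d) → Ω → ℝ}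

theorem memLp_two (hX : IsVariogramField μ X P) (t : EuclideanSpace ℝ (Fin d)) :
    MemLp (X t) 2 P := (hX.gaussian.hasGaussianLaw_eval t).memLp_two

theorem cov_sub_sub (hX : IsVariogramField μ X P) (a b a' b' : EuclideanSpace ℝ (Fin d)) :
    cov[X a - X b, X a' - X b'; P] = halfVariogram μ (a - b') + halfVariogram μ (b - a')
      - halfVariogram μ (a - a') - halfVariogram μ (b - b') := by
  have : IsProbabilityMeasure P := (hX.gaussian.hasGaussianLaw_eval a).isProbabilityMeasure
  rw [covariance_sub_left (hX.memLp_two a) (hX.memLp_two b)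
    ((hX.memLp_two a').sub (hX.memLp_two b')),
    covariance_sub_right (hX.memLp_two a) (hX.memLp_two a') (hX.memLp_two b'),
    covariance_sub_right (hX.memLp_two b) (hX.memLp_two a') (hX.memLp_two b')]
  simp only [hX.cov]
  ring

theorem variance_sub (hX : IsVariogramField μ X P) (a b : EuclideanSpace ℝ (Fin d)) :
    Var[X a - X b; P] = 2 * halfVariogram μ (a - b) := by
  rw [← covariance_self ((hX.memLp_two a).sub (hX.memLp_two b)).aemeasurable, hX.cov_sub_sub,
    ← neg_sub a b, ← neg_one_smul ℝ (a - b), halfVariogram_smul, sub_self, sub_self,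
    halfVariogram_zero]
  norm_num
  ring

theorem integral_sub_eq_zero (hX : IsVariogramField μ X P) (a b : EuclideanSpace ℝ (Fin d)) :
    ∫ ω, (X a - X b) ω ∂P = 0 := by
  simp only [Pi.sub_apply]
  rw [integral_sub (hX.gaussian.hasGaussianLaw_eval a).integrable
    (hX.gaussian.hasGaussianLaw_eval b).integrable, hX.centered, hX.centered, sub_zero]

end IsVariogramField

/-! ### Tail and small-ball estimates for centered Gaussian variables. -/

section GaussianEstimates

variable {Ω : Type*} [MeasurableSpace Ω] {P : Measure Ω}

/-- The absolute moment of order `p` of the standard normal law. -/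
noncomputable def gaussianAbsMoment (p : ℕ) : ℝ := ∫ x, |x| ^ p ∂(gaussianReal 0 1)

theorem gaussianAbsMoment_nonneg (p : ℕ) : 0 ≤ gaussianAbsMoment p :=
  integral_nonneg fun _ => by positivity

/-- Markov's inequality for the `p`-th moment, after rescaling to the standard normal law. Leaving
`p` free gives arbitrarily fast polynomial decay. -/
theorem measureReal_le_abs_of_hasGaussianLaw {Z : Ω → ℝ} (hZ : HasGaussianLaw Z P)
    (h0 : ∫ ω, Z ω ∂P = 0) {v ε : ℝ} (hv : Var[Z; P] ≤ v) (hε : 0 < ε) (p : ℕ) :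
    P.real {ω | ε ≤ |Z ω|} ≤ gaussianAbsMoment p * (√v / ε) ^ p := by
  have hms : MeasurableSet {x : ℝ | ε ≤ |x|} := measurableSet_le measurable_const (by fun_prop)
  set u := Var[Z; P] with hu
  have hu0 : 0 ≤ u := variance_nonneg _ _
  have h1 : P.real {ω | ε ≤ |Z ω|} = (gaussianReal 0 1).real {x | ε ≤ √u * |x|} := by
    have e1 : P.real {ω | ε ≤ |Z ω|} = (P.map Z).real {x | ε ≤ |x|} :=
      (map_measureReal_apply_of_aemeasurable hZ.aemeasurable hms).symm
    have e2 : gaussianReal 0 u.toNNReal = (gaussianReal 0 1).map (fun x => √u * x) := by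
      rw [gaussianReal_map_const_mul, mul_zero, mul_one]
      congr 1
      ext
      simp [hu0]
    rw [e1, hZ.map_eq_gaussianReal, h0, e2, map_measureReal_apply (by fun_prop) hms]
    congr 1
    ext x
    simp [abs_mul, abs_of_nonneg (Real.sqrt_nonneg u)]
  have hint : Integrable (fun x : ℝ => (√u * |x|) ^ p) (gaussianReal 0 1) := by
    simp_rw [mul_pow]
    have := (memLp_id_gaussianReal (μ := 0) (v := 1) p).integrable_norm_pow'
    exact (by simpa using this : Integrable (fun x : ℝ => |x| ^ p) (gaussianReal 0 1)).const_mul _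
  have h2 := mul_meas_ge_le_integral_of_nonneg (μ := gaussianReal 0 1)
    (Eventually.of_forall fun x => by positivity) hint (ε ^ p)
  have h3 : (gaussianReal 0 1).real {x | ε ≤ √u * |x|} ≤
      (gaussianReal 0 1).real {x | ε ^ p ≤ (√u * |x|) ^ p} :=
    measureReal_mono fun x hx => pow_le_pow_left₀ hε.le hx p
  simp_rw [mul_pow] at h2
  rw [integral_const_mul] at h2
  rw [h1]
  have h4 : √u ^ p ≤ √v ^ p := by gcongr
  have h5 := gaussianAbsMoment_nonneg p
  have h6 : √u ^ p * ∫ x, |x| ^ p ∂(gaussianReal 0 1) ≤ √v ^ p * gaussianAbsMoment p :=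
    mul_le_mul_of_nonneg_right h4 h5
  simp_rw [mul_pow] at h3
  rw [div_pow, ← mul_div_assoc, le_div_iff₀ (by positivity)]
  calc _ ≤ _ := mul_le_mul_of_nonneg_right h3 (by positivity)
    _ ≤ _ := by rw [mul_comm, mul_comm (gaussianAbsMoment p)]; exact h2.trans h6

/-- The density is at most `1 / √(2πv)` and the interval has length `2ε`; the constant disappears
because `2 ≤ √(2π)`. -/
theorem measureReal_abs_le_of_hasGaussianLaw {Z : Ω → ℝ} (hZ : HasGaussianLaw Z P)
    (h0 : ∫ ω, Z ω ∂P = 0) (hv : 0 < Var[Z; P]) {ε : ℝ} (hε : 0 ≤ ε) :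
    P.real {ω | |Z ω| ≤ ε} ≤ ε / √(Var[Z; P]) := by
  have hms : MeasurableSet {x : ℝ | |x| ≤ ε} := measurableSet_le (by fun_prop) measurable_const
  have e1 : P.real {ω | |Z ω| ≤ ε} = (P.map Z).real {x | |x| ≤ ε} :=
    (map_measureReal_apply_of_aemeasurable hZ.aemeasurable hms).symm
  have hv' : Var[Z; P].toNNReal ≠ 0 := by simpa using hv
  rw [e1, hZ.map_eq_gaussianReal, h0, measureReal_def, gaussianReal_apply _ hv']
  refine ENNReal.toReal_le_of_le_ofReal (by positivity) ?_
  have hb : ∀ x, gaussianPDF 0 Var[Z; P].toNNReal x ≤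
      ENNReal.ofReal (√(2 * Real.pi * Var[Z; P]))⁻¹ := by
    intro x
    refine ENNReal.ofReal_le_ofReal ?_
    rw [gaussianPDFReal, Real.coe_toNNReal _ hv.le]
    refine mul_le_of_le_one_right (by positivity) (Real.exp_le_one_iff.2 ?_)
    rw [neg_div]
    exact neg_nonpos.2 (by positivity)
  have hset : {x : ℝ | |x| ≤ ε} = Icc (-ε) ε := by ext x; simp [abs_le]
  calc _ ≤ ∫⁻ _ in {x : ℝ | |x| ≤ ε}, ENNReal.ofReal (√(2 * Real.pi * Var[Z; P]))⁻¹ :=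
        lintegral_mono hb
    _ = ENNReal.ofReal ((√(2 * Real.pi * Var[Z; P]))⁻¹ * (2 * ε)) := by
        rw [setLIntegral_const, hset, Real.volume_Icc, ← ENNReal.ofReal_mul (by positivity)]
        ring_nf
    _ ≤ _ := by
        refine ENNReal.ofReal_le_ofReal ?_
        rw [Real.sqrt_mul (by positivity), mul_inv, div_eq_mul_inv]
        have h2 : 2 ≤ √(2 * Real.pi) := Real.le_sqrt_of_sq_le (by linarith [Real.pi_gt_three])
        have h3 : (√(2 * Real.pi))⁻¹ * 2 ≤ 1 := by
          rw [inv_mul_le_iff₀ (by positivity)]; linarith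
        have h4 : 0 ≤ (√(Var[Z; P]))⁻¹ * ε := by positivity
        nlinarith

end GaussianEstimates

/-! ### Dyadic grids and Borel–Cantelli. -/

section Grid

/-- The point `2⁻ⁿ g` of the dyadic grid of level `n`. -/
noncomputable def gridPoint (n : ℕ) (g : Fin d → ℤ) : EuclideanSpace ℝ (Fin d) :=
  WithLp.toLp 2 fun i => (g i : ℝ) / 2 ^ n

/-- The integer coordinates of the grid point of level `n` just below `t`. -/
noncomputable def gridFloor (n : ℕ) (t : EuclideanSpace ℝ (Fin d)) : Fin d → ℤ :=
  fun i => ⌊t i * 2 ^ n⌋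

@[simp] theorem gridPoint_apply (n : ℕ) (g : Fin d → ℤ) (i : Fin d) :
    gridPoint n g i = (g i : ℝ) / 2 ^ n := rfl

theorem gridPoint_sub (n : ℕ) (g g' : Fin d → ℤ) :
    gridPoint n g - gridPoint n g' = gridPoint n (g - g') := by
  ext i; simp [sub_div]

theorem norm_le_of_forall_abs_le {x : EuclideanSpace ℝ (Fin d)} {r : ℝ}
    (h : ∀ i, |x i| ≤ r) : ‖x‖ ≤ d * r := by
  have h1 : ‖x‖ ≤ ∑ i, |x i| := by
    rw [EuclideanSpace.norm_eq]
    refine Real.sqrt_le_iff.2 ⟨Finset.sum_nonneg fun _ _ => abs_nonneg _, ?_⟩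
    simpa using Finset.sum_sq_le_sq_sum_of_nonneg (s := Finset.univ) (f := fun i => |x i|)
      fun _ _ => abs_nonneg _
  refine h1.trans ((Finset.sum_le_sum fun i _ => h i).trans ?_)
  simp

theorem norm_gridPoint_le {n : ℕ} {g : Fin d → ℤ} {m : ℤ} (h : ∀ i, |g i| ≤ m) :
    ‖gridPoint n g‖ ≤ d * m * (1 / 2) ^ n := by
  rw [mul_assoc]
  refine norm_le_of_forall_abs_le fun i => ?_
  rw [gridPoint_apply, abs_div, abs_of_pos (by positivity : (0 : ℝ) < 2 ^ n), one_div, inv_pow,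
    div_eq_mul_inv]
  gcongr
  simpa using (Int.cast_le (R := ℝ)).2 (h i)

theorem norm_sub_gridPoint_gridFloor_le (n : ℕ) (t : EuclideanSpace ℝ (Fin d)) :
    ‖t - gridPoint n (gridFloor n t)‖ ≤ d * (1 / 2) ^ n := by
  refine norm_le_of_forall_abs_le fun i => ?_
  have h2 : (0 : ℝ) < 2 ^ n := by positivity
  have e : t i - gridPoint n (gridFloor n t) i = Int.fract (t i * 2 ^ n) * (1 / 2) ^ n := by
    rw [gridPoint_apply, gridFloor, Int.fract, one_div, inv_pow]
    field_simp
  rw [PiLp.sub_apply, e, abs_of_nonneg (mul_nonneg (Int.fract_nonneg _) (by positivity))]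
  exact mul_le_of_le_one_left (by positivity) (Int.fract_lt_one _).le

theorem abs_gridFloor_le {n R : ℕ} {t : EuclideanSpace ℝ (Fin d)} (ht : ‖t‖ + 1 ≤ R) (i : Fin d) :
    |gridFloor n t i| ≤ R * 2 ^ n := by
  have h1 : |t i| ≤ ‖t‖ := by simpa using PiLp.norm_apply_le t i
  have h2 : (1 : ℝ) ≤ 2 ^ n := one_le_pow₀ (by norm_num)
  have h3 := Int.floor_le (t i * 2 ^ n)
  have h4 := Int.lt_floor_add_one (t i * 2 ^ n)
  obtain ⟨h5, h6⟩ := abs_le.1 (h1.trans (le_sub_iff_add_le.2 ht))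
  have h7 : |((gridFloor n t i : ℤ) : ℝ)| ≤ R * 2 ^ n := by
    rw [abs_le]
    constructor <;> unfold gridFloor <;> nlinarith
  exact_mod_cast h7

theorem gridPoint_succ_two_mul (n : ℕ) (g : Fin d → ℤ) :
    gridPoint (n + 1) (fun i => 2 * g i) = gridPoint n g := by
  ext i
  simp only [gridPoint_apply, pow_succ]
  push_cast
  field_simp

theorem two_mul_gridFloor_sub_mem (n : ℕ) (t : EuclideanSpace ℝ (Fin d)) (i : Fin d) :
    |2 * gridFloor n t i - gridFloor (n + 1) t i| ≤ 1 := by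
  unfold gridFloor
  have h1 := Int.floor_le (t i * 2 ^ n)
  have h2 := Int.lt_floor_add_one (t i * 2 ^ n)
  have h3 := Int.floor_le (t i * 2 ^ (n + 1))
  have h4 := Int.lt_floor_add_one (t i * 2 ^ (n + 1))
  rw [pow_succ] at *
  set a := ⌊t i * 2 ^ n⌋
  set b := ⌊t i * (2 ^ n * 2)⌋
  have h5 : ((2 * a : ℤ) : ℝ) < (b + 1 : ℤ) := by push_cast; linarith
  have h6 : ((b : ℤ) : ℝ) < (2 * a + 2 : ℤ) := by push_cast; linarith
  have h5 := Int.cast_lt.1 h5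
  have h6 := Int.cast_lt.1 h6
  rw [abs_le]; constructor <;> omega

theorem abs_gridFloor_sub_le {n : ℕ} {t t' : EuclideanSpace ℝ (Fin d)}
    (h : ‖t - t'‖ ≤ (1 / 2) ^ n) (i : Fin d) : |gridFloor n t' i - gridFloor n t i| ≤ 1 := by
  have h0 : |t i - t' i| ≤ (1 / 2) ^ n := by
    simpa using (PiLp.norm_apply_le (t - t') i).trans h
  have h7 : |t i * 2 ^ n - t' i * 2 ^ n| ≤ 1 := by
    rw [← sub_mul, abs_mul, abs_of_pos (by positivity : (0 : ℝ) < 2 ^ n)]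
    calc _ ≤ (1 / 2 : ℝ) ^ n * 2 ^ n := by gcongr
      _ = 1 := by rw [← mul_pow]; norm_num
  obtain ⟨h8, h9⟩ := abs_le.1 h7
  unfold gridFloor
  have h1 := Int.floor_le (t i * 2 ^ n)
  have h2 := Int.lt_floor_add_one (t i * 2 ^ n)
  have h3 := Int.floor_le (t' i * 2 ^ n)
  have h4 := Int.lt_floor_add_one (t' i * 2 ^ n)
  set a := ⌊t i * 2 ^ n⌋
  set b := ⌊t' i * 2 ^ n⌋
  have h5 : ((a : ℤ) : ℝ) < (b + 2 : ℤ) := by push_cast; linarith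
  have h6 : ((b : ℤ) : ℝ) < (a + 2 : ℤ) := by push_cast; linarith
  have h5 := Int.cast_lt.1 h5
  have h6 := Int.cast_lt.1 h6
  rw [abs_le]; constructor <;> omega

variable {Ω : Type*} [MeasurableSpace Ω] {P : Measure Ω} [IsProbabilityMeasure P]

/-- Borel–Cantelli along the dyadic grids. -/
theorem ae_forall_eventually_grid_notMem {A : ℕ → (Fin d → ℤ) → Set Ω} {C : ℝ}
    (hA : ∀ n g, P.real (A n g) ≤ C * ((1 / 2) ^ n) ^ (d + 1)) :
    ∀ᵐ ω ∂P, ∀ R : ℕ, ∀ᶠ n in atTop, ∀ g : Fin d → ℤ, (∀ i, |g i| ≤ (R * 2 ^ n : ℤ)) →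
      ω ∉ A n g := by
  rw [ae_all_iff]
  intro R
  let K : ℕ → Finset (Fin d → ℤ) := fun n =>
    Fintype.piFinset fun _ => Finset.Icc (-(R * 2 ^ n : ℤ)) (R * 2 ^ n)
  have hC : 0 ≤ C := by
    have := measureReal_nonneg.trans (hA 0 0)
    simpa using this
  have hK : ∀ n, ((K n).card : ℝ) ≤ ((2 * R + 1) * 2 ^ n) ^ d := by
    intro n
    have h1 : (K n).card = (2 * (R * 2 ^ n) + 1) ^ d := by
      simp only [K, Fintype.card_piFinset, Int.card_Icc, Finset.prod_const, Finset.card_univ,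
        Fintype.card_fin]
      congr 1
      have : (0 : ℤ) ≤ R * 2 ^ n := by positivity
      zify
      rw [Int.toNat_of_nonneg (by linarith)]
      ring
    rw [h1]
    push_cast
    have h2 : (1 : ℝ) ≤ 2 ^ n := one_le_pow₀ (by norm_num)
    gcongr
    linarith
  -- The box holds `O(2 ^ (nd))` grid points, so the exponent `d + 1` leaves a summable factor `2 ^
  -- (-n)`.
  have hb : ∀ n, P.real (⋃ g ∈ K n, A n g) ≤ C * (2 * R + 1) ^ d * (1 / 2) ^ n := by
    intro n
    calc _ ≤ ∑ g ∈ K n, P.real (A n g) := measureReal_biUnion_finset_le _ _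
      _ ≤ ∑ g ∈ K n, C * ((1 / 2) ^ n) ^ (d + 1) := Finset.sum_le_sum fun g _ => hA n g
      _ = (K n).card * (C * ((1 / 2) ^ n) ^ (d + 1)) := by rw [Finset.sum_const, nsmul_eq_mul]
      _ ≤ ((2 * R + 1) * 2 ^ n) ^ d * (C * ((1 / 2) ^ n) ^ (d + 1)) := by gcongr; exact hK n
      _ = C * (2 * R + 1) ^ d * (1 / 2) ^ n * (2 ^ n * (1 / 2) ^ n) ^ d := by
          rw [mul_pow, mul_pow, pow_succ]; ring
      _ = _ := by rw [← mul_pow (2 : ℝ)]; norm_num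
  have hsum : ∑' n, P (⋃ g ∈ K n, A n g) ≠ ∞ := by
    have hs : Summable fun n : ℕ => C * (2 * R + 1) ^ d * (1 / 2 : ℝ) ^ n :=
      summable_geometric_two.mul_left _
    refine ne_top_of_le_ne_top hs.tsum_ofReal_ne_top (ENNReal.tsum_le_tsum fun n => ?_)
    rw [← ofReal_measureReal (measure_ne_top _ _)]
    exact ENNReal.ofReal_le_ofReal (hb n)
  filter_upwards [ae_eventually_notMem hsum] with ω hω
  filter_upwards [hω] with n hn g hg hmem
  refine hn (mem_biUnion (x := g) ?_ hmem)
  exact Fintype.mem_piFinset.2 fun i => Finset.mem_Icc.2 (abs_le.1 (hg i))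

end Grid

/-! ### Uniform Hölder bounds below exponent `1/2`. -/

theorem sqrt_half_pow (n : ℕ) : √((1 / 2 : ℝ) ^ n) = ((1 / 2 : ℝ) ^ (1 / 2 : ℝ)) ^ n := by
  rw [← Real.sqrt_eq_rpow, Real.sqrt_eq_iff_mul_self_eq (by positivity) (by positivity),
    ← mul_pow, Real.mul_self_sqrt (by norm_num)]

/-- Chaining: successive grid approximations of a point are equal or neighbouring points of the
finer grid, so the error from level `n` on is a geometric tail. The constant is one step at level
`n` plus a tail for each endpoint. -/
theorem abs_sub_le_of_gridPoint {f : EuclideanSpace ℝ (Fin d) → ℝ}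
    {S : Set (EuclideanSpace ℝ (Fin d))} {r : ℝ} (hr0 : 0 < r) (hr1 : r < 1) {R n₀ : ℕ}
    (hgrid : ∀ n ≥ n₀, ∀ g : Fin d → ℤ, (∀ i, |g i| ≤ (R * 2 ^ n : ℤ)) → ∀ k : Fin d → ℤ,
      (∀ i, |k i| ≤ 1) → |f (gridPoint n g) - f (gridPoint n (g + k))| ≤ r ^ n)
    (hlim : ∀ s ∈ S, Tendsto (fun n => f (gridPoint n (gridFloor n s))) atTop (𝓝 (f s)))
    {n : ℕ} (hn : n₀ ≤ n) {s s' : EuclideanSpace ℝ (Fin d)} (hs : s ∈ S) (hs' : s' ∈ S)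
    (hsR : ‖s‖ + 1 ≤ R) (hsR' : ‖s'‖ + 1 ≤ R) (hss' : ‖s - s'‖ ≤ (1 / 2) ^ n) :
    |f s - f s'| ≤ (1 + 2 * (1 / (1 - r))) * r ^ n := by
  have key : ∀ u ∈ S, ‖u‖ + 1 ≤ R →
      |f (gridPoint n (gridFloor n u)) - f u| ≤ r ^ n / (1 - r) := by
    intro u hu huR
    refine dist_le_of_le_geometric_of_tendsto₀ r (r ^ n)
      (f := fun m => f (gridPoint (n + m) (gridFloor (n + m) u))) hr1 (fun m => ?_)
      ((hlim u hu).comp (tendsto_add_atTop_nat n |>.congr fun m => add_comm m n))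
    have h1 := hgrid (n + m + 1) (by omega) (gridFloor (n + m + 1) u)
      (abs_gridFloor_le huR) ((fun i => 2 * gridFloor (n + m) u i) - gridFloor (n + m + 1) u)
      fun i => two_mul_gridFloor_sub_mem (n + m) u i
    rw [add_sub_cancel, gridPoint_succ_two_mul] at h1
    rw [dist_comm, Real.dist_eq, ← pow_add]
    exact h1.trans (pow_le_pow_of_le_one hr0.le hr1.le (by omega))
  have h1 := key s hs hsR
  have h2 := key s' hs' hsR'
  have h3 := hgrid n hn (gridFloor n s) (abs_gridFloor_le hsR) (gridFloor n s' - gridFloor n s)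
    fun i => abs_gridFloor_sub_le hss' i
  rw [add_sub_cancel] at h3
  rw [abs_le] at *
  have h4 : (1 + 2 * (1 / (1 - r))) * r ^ n = r ^ n + 2 * (r ^ n / (1 - r)) := by ring
  rw [h4]
  constructor <;> linarith [h1.1, h1.2, h2.1, h2.2, h3.1, h3.2]

/-- A closed ball of values containing the path on `U ∩ S` contains it on all of `U`. Taking for `U`
a small ball around `t₀` that also contains `t` transfers the modulus from `S` to arbitrary points.
-/
theorem eventually_abs_sub_le_of_separable {f : EuclideanSpace ℝ (Fin d) → ℝ}
    {S : Set (EuclideanSpace ℝ (Fin d))} (hS : Dense S)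
    (hsep : ∀ U : Set (EuclideanSpace ℝ (Fin d)), IsOpen U → ∀ F : Set ℝ, IsClosed F →
      (∀ t ∈ U ∩ S, f t ∈ F) → ∀ t ∈ U, f t ∈ F)
    {α C : ℝ} (hα : 0 < α) (hC : 0 ≤ C)
    (hmod : ∀ R : ℕ, ∃ n₀, ∀ n ≥ n₀, ∀ s ∈ S, ∀ s' ∈ S, ‖s‖ + 1 ≤ R → ‖s'‖ + 1 ≤ R →
      ‖s - s'‖ ≤ (1 / 2) ^ n → |f s - f s'| ≤ C * ((1 / 2 : ℝ) ^ α) ^ n)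
    (t₀ : EuclideanSpace ℝ (Fin d)) :
    ∃ C' : ℝ, 0 < C' ∧ ∀ᶠ t in 𝓝 t₀, |f t - f t₀| ≤ C' * ‖t - t₀‖ ^ α := by
  obtain ⟨n₀, hn₀⟩ := hmod (⌈‖t₀‖⌉₊ + 3)
  refine ⟨2 * C * 8 ^ α + 1, by positivity, ?_⟩
  have hδ : (0 : ℝ) < (1 / 2) ^ n₀ / 4 := by positivity
  have hδ1 : ((1 : ℝ) / 2) ^ n₀ ≤ 1 := pow_le_one₀ (by norm_num) (by norm_num)
  filter_upwards [Metric.ball_mem_nhds t₀ hδ] with t ht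
  rw [mem_ball_iff_norm] at ht
  rcases eq_or_ne t t₀ with rfl | hne
  · simp only [sub_self, abs_zero]
    positivity
  have hh : 0 < ‖t - t₀‖ := norm_sub_pos_iff.2 hne
  set h := ‖t - t₀‖ with hdef
  -- Points of the ball of radius `2h` are within `4h` of each other, so `n` is the finest level
  -- with `4h ≤ 2 ^ (-n)`. Then `2 ^ (-n) < 8h`, whence the constant `8 ^ α`.
  obtain ⟨n, hn1, hn2⟩ := exists_nat_pow_near_of_lt_one (x := 4 * h) (y := (1 / 2 : ℝ))
    (by positivity) (by linarith) (by norm_num) (by norm_num)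
  have hn : n₀ ≤ n := by
    by_contra! hlt
    have : ((1 : ℝ) / 2) ^ n₀ ≤ (1 / 2) ^ (n + 1) :=
      pow_le_pow_of_le_one (by norm_num) (by norm_num) hlt
    linarith
  have hU : IsOpen (Metric.ball t₀ (2 * h)) := Metric.isOpen_ball
  have hbnd : ∀ s ∈ Metric.ball t₀ (2 * h), ‖s‖ + 1 ≤ (⌈‖t₀‖⌉₊ + 3 : ℕ) := by
    intro s hs
    rw [mem_ball_iff_norm] at hs
    have h1 := norm_le_norm_add_norm_sub t₀ s
    have h2 := Nat.le_ceil ‖t₀‖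
    push_cast
    rw [norm_sub_rev] at h1
    linarith
  have hpow : ((1 / 2 : ℝ) ^ α) ^ n ≤ 8 ^ α * h ^ α := by
    rw [← Real.rpow_natCast, ← Real.rpow_mul (by norm_num), mul_comm, Real.rpow_mul (by norm_num),
      Real.rpow_natCast, ← Real.mul_rpow (by norm_num) hh.le]
    refine Real.rpow_le_rpow (by positivity) ?_ hα.le
    rw [pow_succ] at hn1
    linarith
  obtain ⟨s', hs'U, hs'S⟩ := hS.inter_open_nonempty _ hU ⟨t₀, by simp [hh]⟩
  have hF := hsep _ hU (Metric.closedBall (f s') (C * (8 ^ α * h ^ α))) Metric.isClosed_closedBall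
    fun s hs => by
      rw [Metric.mem_closedBall, Real.dist_eq]
      refine (hn₀ n hn s hs.2 s' hs'S (hbnd s hs.1) (hbnd s' hs'U) ?_).trans (by gcongr)
      have h1 := hs.1
      rw [Metric.mem_ball] at h1 hs'U
      rw [← dist_eq_norm]
      linarith [dist_triangle_right s s' t₀]
  have h1 := hF t (by rw [mem_ball_iff_norm]; linarith)
  have h2 := hF t₀ (by simp [hh])
  rw [Metric.mem_closedBall, Real.dist_eq, abs_le] at h1 h2
  have h3 : 0 ≤ h ^ α := by positivity
  have h4 : (2 * C * 8 ^ α + 1) * h ^ α = 2 * (C * (8 ^ α * h ^ α)) + h ^ α := by ring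
  rw [h4, abs_le]
  constructor <;> linarith [h1.1, h1.2, h2.1, h2.2]

namespace IsVariogramField

variable {Ω : Type*} [MeasurableSpace Ω] {P : Measure Ω} {μ : Measure (UnitSphere d)}
  [IsFiniteMeasure μ] {X : EuclideanSpace ℝ (Fin d) → Ω → ℝ}

theorem exists_measureReal_increment_le (hX : IsVariogramField μ X P) {α : ℝ} (hα : α < 1 / 2)
    (m : ℝ) : ∃ C : ℝ, 0 ≤ C ∧ ∀ (n : ℕ) (x y : EuclideanSpace ℝ (Fin d)),
      ‖x - y‖ ≤ m * (1 / 2) ^ n →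
      P.real {ω | ((1 / 2 : ℝ) ^ α) ^ n ≤ |X x ω - X y ω|} ≤ C * ((1 / 2) ^ n) ^ (d + 1) := by
  -- The standard deviation is `O(2 ^ (-n/2))` and the threshold `2 ^ (-αn)`; this `p` satisfies `p
  -- (1/2 - α) > d + 1`.
  obtain ⟨p, hp⟩ := exists_pow_lt_of_lt_one (x := ((1 / 2 : ℝ) ^ (d + 1)))
    (y := (1 / 2 : ℝ) ^ (1 / 2 - α)) (by positivity)
    (Real.rpow_lt_one (by norm_num) (by norm_num) (by linarith))
  set c := 2 * (μ.real univ * m) with hc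
  refine ⟨gaussianAbsMoment p * √c ^ p,
    mul_nonneg (gaussianAbsMoment_nonneg p) (by positivity), fun n x y hxy => ?_⟩
  have hm : 0 ≤ m := by
    by_contra! hlt
    have : m * (1 / 2) ^ n < 0 := mul_neg_of_neg_of_pos hlt (by positivity)
    linarith [norm_nonneg (x - y)]
  have hv : Var[X x - X y; P] ≤ c * (1 / 2) ^ n := by
    rw [hX.variance_sub]
    have h1 := halfVariogram_le μ (x - y)
    have h2 : μ.real univ * ‖x - y‖ ≤ μ.real univ * (m * (1 / 2) ^ n) := by gcongr
    rw [hc]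
    linarith
  refine (measureReal_le_abs_of_hasGaussianLaw (hX.gaussian.hasGaussianLaw_sub (s := x) (t := y))
    (hX.integral_sub_eq_zero x y) hv (ε := ((1 / 2 : ℝ) ^ α) ^ n) (by positivity) p).trans ?_
  have h1 : √(c * (1 / 2) ^ n) / ((1 / 2 : ℝ) ^ α) ^ n =
      √c * ((1 / 2 : ℝ) ^ (1 / 2 - α)) ^ n := by
    rw [Real.sqrt_mul (by positivity), sqrt_half_pow, mul_div_assoc, ← div_pow,
      ← Real.rpow_sub (by norm_num)]
  rw [h1, mul_pow, ← mul_assoc, ← pow_mul, mul_comm n p, pow_mul _ p n, ← pow_mul _ n,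
    mul_comm n, pow_mul _ (d + 1) n]
  have h5 := gaussianAbsMoment_nonneg p
  gcongr

/-- Path continuity is not yet available. For one fixed point, summable deviation probabilities
suffice, and countability of `S` then gives a common null event. The exponent `1/4` is an arbitrary
choice in `(0, 1/2)`. -/
theorem ae_tendsto_gridFloor [IsProbabilityMeasure P] (hX : IsVariogramField μ X P)
    (s : EuclideanSpace ℝ (Fin d)) :
    ∀ᵐ ω ∂P, Tendsto (fun n => X (gridPoint n (gridFloor n s)) ω) atTop (𝓝 (X s ω)) := by
  obtain ⟨C, hC0, hC⟩ := hX.exists_measureReal_increment_le (α := 1 / 4) (by norm_num) d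
  have hr : (1 / 2 : ℝ) ^ (1 / 4 : ℝ) < 1 :=
    Real.rpow_lt_one (by norm_num) (by norm_num) (by norm_num)
  have hsum : ∑' n, P {ω | ((1 / 2 : ℝ) ^ (1 / 4 : ℝ)) ^ n ≤
      |X s ω - X (gridPoint n (gridFloor n s)) ω|} ≠ ∞ := by
    have hs : Summable fun n : ℕ => C * (1 / 2 : ℝ) ^ n := summable_geometric_two.mul_left _
    refine ne_top_of_le_ne_top hs.tsum_ofReal_ne_top (ENNReal.tsum_le_tsum fun n => ?_)
    rw [← ofReal_measureReal (measure_ne_top _ _)]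
    refine ENNReal.ofReal_le_ofReal
      ((hC n s _ (norm_sub_gridPoint_gridFloor_le n s)).trans ?_)
    have h1 : ((1 : ℝ) / 2) ^ n ≤ 1 := pow_le_one₀ (by norm_num) (by norm_num)
    gcongr
    exact pow_le_of_le_one (by positivity) h1 (by omega)
  filter_upwards [ae_eventually_notMem hsum] with ω hω
  rw [tendsto_iff_dist_tendsto_zero]
  refine squeeze_zero' (Eventually.of_forall fun _ => dist_nonneg) ?_
    (tendsto_pow_atTop_nhds_zero_of_lt_one (by positivity) hr)
  filter_upwards [hω] with n hn
  rw [dist_comm, Real.dist_eq]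
  exact (not_le.1 hn).le

theorem ae_modulus_le [IsProbabilityMeasure P] (hX : IsVariogramField μ X P)
    {S : Set (EuclideanSpace ℝ (Fin d))} (hS : S.Countable) {α : ℝ} (hα0 : 0 < α)
    (hα : α < 1 / 2) :
    ∀ᵐ ω ∂P, ∀ R : ℕ, ∃ n₀, ∀ n ≥ n₀, ∀ s ∈ S, ∀ s' ∈ S, ‖s‖ + 1 ≤ R → ‖s'‖ + 1 ≤ R →
      ‖s - s'‖ ≤ (1 / 2) ^ n →
      |X s ω - X s' ω| ≤ (1 + 2 * (1 / (1 - (1 / 2 : ℝ) ^ α))) * ((1 / 2 : ℝ) ^ α) ^ n := by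
  obtain ⟨C, hC0, hC⟩ := hX.exists_measureReal_increment_le hα d
  have hr : (1 / 2 : ℝ) ^ α < 1 := Real.rpow_lt_one (by norm_num) (by norm_num) hα0
  let K : Finset (Fin d → ℤ) := Fintype.piFinset fun _ => Finset.Icc (-1) 1
  have hK : ∀ k : Fin d → ℤ, k ∈ K ↔ ∀ i, |k i| ≤ 1 := fun k => by
    simp only [K, Fintype.mem_piFinset, Finset.mem_Icc, abs_le]
  -- All `3 ^ d` neighbour shifts are merged into one bad event per grid point.
  have hA : ∀ (n : ℕ) (g : Fin d → ℤ), P.real (⋃ k ∈ K, {ω | ((1 / 2 : ℝ) ^ α) ^ n ≤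
      |X (gridPoint n g) ω - X (gridPoint n (g + k)) ω|}) ≤
      (K.card * C) * ((1 / 2) ^ n) ^ (d + 1) := by
    intro n g
    refine (measureReal_biUnion_finset_le _ _).trans
      ((Finset.sum_le_sum fun k hk => hC n _ _ ?_).trans ?_)
    · rw [gridPoint_sub, sub_add_cancel_left]
      simpa using norm_gridPoint_le (n := n) (g := -k) (m := 1) fun i => by
        simpa using (hK k).1 hk i
    · rw [Finset.sum_const, nsmul_eq_mul, mul_assoc]
  filter_upwards [ae_forall_eventually_grid_notMem hA,
    (ae_ball_iff hS).2 fun s _ => hX.ae_tendsto_gridFloor s] with ω h1 h2 R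
  obtain ⟨n₀, hn₀⟩ := eventually_atTop.1 (h1 R)
  refine ⟨n₀, fun n hn s hs s' hs' hsR hsR' hss' => ?_⟩
  refine abs_sub_le_of_gridPoint (f := fun t => X t ω) (by positivity) hr
    (fun n hn g hg k hk => ?_) h2 hn hs hs' hsR hsR' hss'
  have h3 := hn₀ n hn g hg
  simp only [mem_iUnion, not_exists] at h3
  exact (not_le.1 (h3 k ((hK k).2 hk))).le

end IsVariogramField

/-! ### Independent increments along lines and failure of regularity above `1/2`. -/

namespace IsVariogramField

variable {Ω : Type*} [MeasurableSpace Ω] {P : Measure Ω} {μ : Measure (UnitSphere d)}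
  {X : EuclideanSpace ℝ (Fin d) → Ω → ℝ}

/-- By homogeneity the covariance is `w u` times a signed sum of four absolute values. For
non-overlapping intervals these have arguments of a common sign and cancel, as for Brownian motion.
-/
theorem cov_increments_line (hX : IsVariogramField μ X P) (a u : EuclideanSpace ℝ (Fin d))
    {j k : ℕ} (hjk : j ≠ k) :
    cov[X (a + ((j + 1 : ℕ) : ℝ) • u) - X (a + (j : ℝ) • u),
      X (a + ((k + 1 : ℕ) : ℝ) • u) - X (a + (k : ℝ) • u); P] = 0 := by
  rw [hX.cov_sub_sub]
  simp only [add_sub_add_left_eq_sub, ← sub_smul, halfVariogram_smul]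
  rw [← add_mul, ← sub_mul, ← sub_mul]
  refine mul_eq_zero_of_left ?_ _
  push_cast
  rcases lt_or_gt_of_ne hjk with h | h
  · have h1 : (j : ℝ) + 1 ≤ k := by exact_mod_cast h
    rw [abs_of_nonpos (by linarith), abs_of_nonpos (by linarith), abs_of_nonpos (by linarith),
      abs_of_nonpos (by linarith)]
    ring
  · have h1 : (k : ℝ) + 1 ≤ j := by exact_mod_cast h
    rw [abs_of_nonneg (by linarith), abs_of_nonneg (by linarith), abs_of_nonneg (by linarith),
      abs_of_nonneg (by linarith)]
    ring

theorem measureReal_increments_line_le (hX : IsVariogramField μ X P)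
    (a u : EuclideanSpace ℝ (Fin d)) (hu : 0 < halfVariogram μ u) (M : ℕ) {ε : ℝ} (hε : 0 ≤ ε) :
    P.real (⋂ j : Fin M, {ω | |X (a + ((j + 1 : ℕ) : ℝ) • u) ω - X (a + (j : ℝ) • u) ω| ≤ ε}) ≤
      (ε / √(2 * halfVariogram μ u)) ^ M := by
  set Y : Fin M → Ω → ℝ :=
    fun j => X (a + ((j + 1 : ℕ) : ℝ) • u) - X (a + (j : ℝ) • u) with hY
  have hgauss : HasGaussianLaw (fun ω => (Y · ω)) P := by
    simpa [hY] using hX.gaussian.hasGaussianLaw_increments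
      (t := fun j : Fin (M + 1) => a + ((j : ℕ) : ℝ) • u)
  -- Jointly Gaussian and uncorrelated variables are independent.
  have hind : iIndepFun Y P := hgauss.iIndepFun_of_covariance_eq_zero fun j k hjk =>
    hX.cov_increments_line a u fun h => hjk (Fin.ext h)
  have hms : MeasurableSet {x : ℝ | |x| ≤ ε} := measurableSet_le (by fun_prop) measurable_const
  have h1 := hind.measure_inter_preimage_eq_mul Finset.univ (sets := fun _ => {x : ℝ | |x| ≤ ε})
    fun _ _ => hms
  simp only [Finset.mem_univ, iInter_true] at h1
  have h2 : P.real (⋂ j : Fin M, {ω | |Y j ω| ≤ ε}) = ∏ j : Fin M, P.real {ω | |Y j ω| ≤ ε} := by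
    rw [measureReal_def]
    simp only [measureReal_def, ← ENNReal.toReal_prod]
    exact congrArg ENNReal.toReal h1
  refine h2.trans_le ((Finset.prod_le_prod (fun _ _ => measureReal_nonneg)
    (g := fun _ => ε / √(2 * halfVariogram μ u)) fun j _ => ?_).trans_eq
    (by rw [Finset.prod_const, Finset.card_univ, Fintype.card_fin]))
  have hv : Var[Y j; P] = 2 * halfVariogram μ u := by
    rw [hY, hX.variance_sub, add_sub_add_left_eq_sub, ← sub_smul]
    simp
  rw [← hv]
  exact measureReal_abs_le_of_hasGaussianLaw hX.gaussian.hasGaussianLaw_sub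
    (hX.integral_sub_eq_zero _ _) (by rw [hv]; positivity) hε

end IsVariogramField

theorem gridPoint_add_single (n : ℕ) (g : Fin d → ℤ) (i : Fin d) (j : ℕ) :
    gridPoint n (g + Pi.single i (j : ℤ)) =
      gridPoint n g + (j : ℝ) • ((1 / 2 : ℝ) ^ n • EuclideanSpace.single i (1 : ℝ)) := by
  ext k
  rcases eq_or_ne k i with rfl | h
  · simp [div_eq_mul_inv, add_mul]
  · simp [h]

/-- If a path is Hölder regular with exponent `β` at some point, then on every fine dyadic grid it
has many consecutive small increments near that point. -/
theorem exists_increments_le {f : EuclideanSpace ℝ (Fin d) → ℝ} {t₀ : EuclideanSpace ℝ (Fin d)}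
    {β C : ℝ} (hβ : 0 < β)
    (hf : ∀ᶠ t in 𝓝 t₀, |f t - f t₀| ≤ C * ‖t - t₀‖ ^ β) (i : Fin d) (M : ℕ) :
    ∃ L : ℕ, ∀ᶠ n in atTop, ∀ j : Fin M,
      |f (gridPoint n (gridFloor n t₀ + Pi.single i ((j + 1 : ℕ) : ℤ))) -
        f (gridPoint n (gridFloor n t₀ + Pi.single i ((j : ℕ) : ℤ)))| ≤
        L * ((1 / 2 : ℝ) ^ β) ^ n := by
  obtain ⟨δ, hδ, hball⟩ := Metric.eventually_nhds_iff_ball.1 hf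
  -- The grid points used lie within `(d + M) 2 ^ (-n)` of `t₀`; the factor 2 comes from comparing
  -- both ends of an increment with `f t₀`. Rounding up to a natural number leaves only countably
  -- many constants to exclude.
  obtain ⟨L, hL⟩ := exists_nat_ge (2 * |C| * (d + M : ℝ) ^ β)
  refine ⟨L, ?_⟩
  have hlim : Tendsto (fun n : ℕ => (d + M : ℝ) * (1 / 2) ^ n) atTop (𝓝 0) := by
    simpa using (tendsto_pow_atTop_nhds_zero_of_lt_one (r := (1 / 2 : ℝ)) (by norm_num)
      (by norm_num)).const_mul (d + M : ℝ)
  filter_upwards [hlim.eventually_lt_const hδ] with n hn j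
  have key : ∀ k : ℕ, k ≤ M →
      |f (gridPoint n (gridFloor n t₀ + Pi.single i (k : ℤ))) - f t₀| ≤
        |C| * (d + M : ℝ) ^ β * ((1 / 2 : ℝ) ^ β) ^ n := by
    intro k hk
    set y := gridPoint n (gridFloor n t₀ + Pi.single i (k : ℤ)) with hy
    have h1 : ‖y - t₀‖ ≤ (d + M : ℝ) * (1 / 2) ^ n := by
      have e : y - t₀ = -(t₀ - gridPoint n (gridFloor n t₀)) +
          (k : ℝ) • ((1 / 2 : ℝ) ^ n • EuclideanSpace.single i (1 : ℝ)) := by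
        rw [hy, gridPoint_add_single]
        abel
      rw [e]
      refine (norm_add_le _ _).trans ?_
      rw [norm_neg, norm_smul, norm_smul, PiLp.norm_single, norm_one, mul_one, add_mul,
        Real.norm_of_nonneg (by positivity), Real.norm_of_nonneg (by positivity)]
      gcongr
      exact norm_sub_gridPoint_gridFloor_le n t₀
    refine (hball y (by rw [mem_ball_iff_norm]; linarith)).trans ?_
    calc C * ‖y - t₀‖ ^ β ≤ |C| * ((d + M : ℝ) * (1 / 2) ^ n) ^ β := by
          gcongr
          exact le_abs_self C
      _ = _ := by
          rw [Real.mul_rpow (by positivity) (by positivity), ← Real.rpow_natCast,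
            ← Real.rpow_natCast, ← Real.rpow_mul (by norm_num), ← Real.rpow_mul (by norm_num),
            mul_comm (n : ℝ), mul_assoc]
  have h1 := key (j + 1) j.2
  have h2 := key j j.2.le
  have h3 : 2 * (|C| * (d + M : ℝ) ^ β * ((1 / 2 : ℝ) ^ β) ^ n) ≤ L * ((1 / 2 : ℝ) ^ β) ^ n := by
    rw [← mul_assoc, ← mul_assoc]
    gcongr
  rw [abs_le] at *
  constructor <;> linarith [h1.1, h1.2, h2.1, h2.2]

theorem IsVariogramField.ae_not_holder {Ω : Type*} [MeasurableSpace Ω] {P : Measure Ω}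
    [IsProbabilityMeasure P] {μ : Measure (UnitSphere d)} [IsFiniteMeasure μ] (hμ : μ ≠ 0)
    {X : EuclideanSpace ℝ (Fin d) → Ω → ℝ} (hX : IsVariogramField μ X P) {β : ℝ}
    (hβ : 1 / 2 < β) :
    ∀ᵐ ω ∂P, ∀ t₀ C, ¬ ∀ᶠ t in 𝓝 t₀, |X t ω - X t₀ ω| ≤ C * ‖t - t₀‖ ^ β := by
  obtain ⟨i, hi⟩ := exists_halfVariogram_pos μ hμ
  set e : EuclideanSpace ℝ (Fin d) := EuclideanSpace.single i 1
  -- Each small increment costs a factor of order `2 ^ (-n(β - 1/2))`; this `M` satisfies `M (β -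
  -- 1/2) > d + 1`.
  obtain ⟨M, hM⟩ := exists_pow_lt_of_lt_one (x := ((1 / 2 : ℝ) ^ (d + 1)))
    (y := (1 / 2 : ℝ) ^ (β - 1 / 2)) (by positivity)
    (Real.rpow_lt_one (by norm_num) (by norm_num) (by linarith))
  let A : ℕ → ℕ → (Fin d → ℤ) → Set Ω := fun L n g => ⋂ j : Fin M,
    {ω | |X (gridPoint n (g + Pi.single i ((j + 1 : ℕ) : ℤ))) ω -
      X (gridPoint n (g + Pi.single i ((j : ℕ) : ℤ))) ω| ≤ L * ((1 / 2 : ℝ) ^ β) ^ n}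
  have hA : ∀ (L n : ℕ) (g : Fin d → ℤ), P.real (A L n g) ≤
      (L / √(2 * halfVariogram μ e)) ^ M * ((1 / 2) ^ n) ^ (d + 1) := by
    intro L n g
    have hw : halfVariogram μ ((1 / 2 : ℝ) ^ n • e) = halfVariogram μ e * (1 / 2) ^ n := by
      rw [halfVariogram_smul, abs_of_pos (by positivity), mul_comm]
    have h1 := hX.measureReal_increments_line_le (gridPoint n g) ((1 / 2 : ℝ) ^ n • e)
      (by rw [hw]; positivity) M (ε := L * ((1 / 2 : ℝ) ^ β) ^ n) (by positivity)
    simp only [e, ← gridPoint_add_single] at h1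
    refine h1.trans ?_
    rw [hw, ← mul_assoc, Real.sqrt_mul (by positivity), sqrt_half_pow, mul_div_mul_comm, ← div_pow,
      ← Real.rpow_sub (by norm_num), mul_pow, ← pow_mul _ n M, mul_comm n M, pow_mul _ M n,
      ← pow_mul _ n, mul_comm n, pow_mul _ (d + 1) n]
    gcongr
  filter_upwards [ae_all_iff.2 fun L => ae_forall_eventually_grid_notMem (hA L)] with ω hω t₀ C hC
  obtain ⟨L, hL⟩ := exists_increments_le (f := fun t => X t ω) (by linarith) hC i M
  obtain ⟨R, hR⟩ := exists_nat_ge (‖t₀‖ + 1)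
  obtain ⟨n, h1, h2⟩ := (hL.and (hω L R)).exists
  exact h2 (gridFloor n t₀) (fun j => abs_gridFloor_le hR j) (mem_iInter.2 h1)

/-! ### From increment bounds to the Hölder exponent and the spectrum. -/

theorem memHolderAt_of_eventually_le {f : EuclideanSpace ℝ (Fin d) → ℝ}
    {t₀ : EuclideanSpace ℝ (Fin d)} {α C : ℝ} (hα : 0 < α) (hC : 0 < C)
    (h : ∀ᶠ t in 𝓝 t₀, |f t - f t₀| ≤ C * ‖t - t₀‖ ^ α) : MemHolderAt f α t₀ :=
  ⟨C, hC, MvPolynomial.C (f t₀), by simpa using hα, by simpa using h⟩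

/-- Up to order one the polynomial may be replaced by the constant `f t₀`, since it is
differentiable and its own increments are `O(‖t - t₀‖)`. -/
theorem MemHolderAt.exists_eventually_le {f : EuclideanSpace ℝ (Fin d) → ℝ}
    {t₀ : EuclideanSpace ℝ (Fin d)} {α β : ℝ} (h : MemHolderAt f α t₀) (hβ : 0 < β)
    (hβα : β ≤ α) (hβ1 : β ≤ 1) :
    ∃ C : ℝ, ∀ᶠ t in 𝓝 t₀, |f t - f t₀| ≤ C * ‖t - t₀‖ ^ β := by
  obtain ⟨C, hC, Q, -, hQ⟩ := h
  set q : EuclideanSpace ℝ (Fin d) → ℝ := fun t => MvPolynomial.eval (fun i => t i) Q with hq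
  have hdiff : DifferentiableAt ℝ q t₀ :=
    (AnalyticAt.aeval_mvPolynomial (f := fun (t : EuclideanSpace ℝ (Fin d)) i => t i)
      (fun i => (EuclideanSpace.proj i : EuclideanSpace ℝ (Fin d) →L[ℝ] ℝ).analyticAt t₀)
      Q).differentiableAt
  obtain ⟨K, hK⟩ := hdiff.isBigO_sub.bound
  have h0 : f t₀ = q t₀ := by
    -- At `t = t₀` the error bound is `0 ^ α = 0`, so the polynomial takes the value `f t₀` there.
    have := hQ.self_of_nhds
    rw [sub_self, norm_zero, Real.zero_rpow (by linarith), mul_zero] at this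
    exact sub_eq_zero.1 (abs_nonpos_iff.1 this)
  refine ⟨C + |K|, ?_⟩
  filter_upwards [hQ, hK, Metric.ball_mem_nhds t₀ one_pos] with t h1 h2 h3
  rw [mem_ball_iff_norm] at h3
  have h4 : ‖t - t₀‖ ^ α ≤ ‖t - t₀‖ ^ β :=
    Real.rpow_le_rpow_of_exponent_ge_of_imp (norm_nonneg _) h3.le hβα fun _ h => by linarith
  have h5 : ‖t - t₀‖ ≤ ‖t - t₀‖ ^ β := by
    simpa using Real.rpow_le_rpow_of_exponent_ge_of_imp (norm_nonneg (t - t₀)) h3.le hβ1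
      fun _ h => by linarith
  calc |f t - f t₀| = |(f t - q t) + (q t - q t₀)| := by rw [h0]; congr 1; ring
    _ ≤ |f t - q t| + |q t - q t₀| := abs_add_le _ _
    _ ≤ C * ‖t - t₀‖ ^ β + |K| * ‖t - t₀‖ ^ β := by
        refine add_le_add (h1.trans (by gcongr)) (h2.trans ?_)
        exact mul_le_mul (le_abs_self K) h5 (norm_nonneg _) (abs_nonneg K)
    _ = _ := by ring

/-- Sequences of exponents suffice, which keeps the almost sure statements countable. The shifts
ensure `1/2 - 1/(m + 3) > 0` and `1/2 + 1/(m + 2) ≤ 1`, the latter so that polynomials reduce to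
constants. -/
theorem holderExponent_eq_half {f : EuclideanSpace ℝ (Fin d) → ℝ}
    {t₀ : EuclideanSpace ℝ (Fin d)}
    (hlow : ∀ m : ℕ, ∃ C : ℝ, 0 < C ∧
      ∀ᶠ t in 𝓝 t₀, |f t - f t₀| ≤ C * ‖t - t₀‖ ^ (1 / 2 - 1 / (m + 3) : ℝ))
    (hup : ∀ m : ℕ, ∀ C : ℝ,
      ¬ ∀ᶠ t in 𝓝 t₀, |f t - f t₀| ≤ C * ‖t - t₀‖ ^ (1 / 2 + 1 / (m + 2) : ℝ)) :
    holderExponent f t₀ = 1 / 2 := by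
  have hhalf : ENNReal.ofReal (1 / 2) = 1 / 2 := by
    rw [ENNReal.ofReal_div_of_pos two_pos]; simp
  rw [← hhalf]
  refine le_antisymm (sSup_le ?_) ?_
  · rintro _ ⟨α, -, hmem, rfl⟩
    refine ENNReal.ofReal_le_ofReal ?_
    by_contra! hlt
    obtain ⟨m, hm⟩ := exists_nat_one_div_lt (sub_pos.2 hlt)
    have hle : (1 : ℝ) / (m + 2) ≤ 1 / (m + 1) :=
      one_div_le_one_div_of_le (by positivity) (by linarith)
    have hle' : (1 : ℝ) / (m + 2) ≤ 1 / 2 :=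
      one_div_le_one_div_of_le two_pos (by linarith [Nat.cast_nonneg (α := ℝ) m])
    obtain ⟨C, hC⟩ := hmem.exists_eventually_le (β := 1 / 2 + 1 / (m + 2)) (by positivity)
      (by linarith) (by linarith)
    exact hup m C hC
  · have hlim : Tendsto (fun m : ℕ => ENNReal.ofReal (1 / 2 - 1 / (m + 3))) atTop
        (𝓝 (ENNReal.ofReal (1 / 2))) := by
      refine ENNReal.tendsto_ofReal ?_
      have h1 : Tendsto (fun m : ℕ => (1 : ℝ) / (m + 3)) atTop (𝓝 0) :=
        Tendsto.const_div_atTop (tendsto_atTop_add_const_right _ _ tendsto_natCast_atTop_atTop) 1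
      simpa using h1.const_sub (1 / 2 : ℝ)
    refine le_of_tendsto' hlim fun m => le_sSup ?_
    obtain ⟨C, hC0, hC⟩ := hlow m
    have hpos : (0 : ℝ) < 1 / 2 - 1 / (m + 3) :=
      sub_pos.2 (one_div_lt_one_div_of_lt two_pos (by linarith [Nat.cast_nonneg (α := ℝ) m]))
    exact ⟨_, hpos, memHolderAt_of_eventually_le hpos hC0 hC, rfl⟩

theorem isLocallyBounded_of_eventually_le {f : EuclideanSpace ℝ (Fin d) → ℝ} {α : ℝ} (hα : 0 ≤ α)
    (h : ∀ t₀, ∃ C : ℝ, 0 < C ∧ ∀ᶠ t in 𝓝 t₀, |f t - f t₀| ≤ C * ‖t - t₀‖ ^ α) :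
    IsLocallyBounded f := by
  intro t₀
  obtain ⟨C, hC0, hC⟩ := h t₀
  refine ⟨C + |f t₀|, ?_⟩
  filter_upwards [hC, Metric.ball_mem_nhds t₀ one_pos] with t h1 h2
  rw [mem_ball_iff_norm] at h2
  have h3 : ‖t - t₀‖ ^ α ≤ 1 := Real.rpow_le_one (norm_nonneg _) h2.le hα
  have h4 : C * ‖t - t₀‖ ^ α ≤ C := mul_le_of_le_one_right hC0.le h3
  linarith [abs_sub_abs_le_abs_sub (f t) (f t₀)]

theorem localSpectrum_eq {f : EuclideanSpace ℝ (Fin d) → ℝ} {h₀ : ℝ≥0∞}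
    (hf : ∀ t, holderExponent f t = h₀) (h : ℝ≥0∞) {W : Set (EuclideanSpace ℝ (Fin d))}
    (hW : IsOpen W) (hWn : W.Nonempty) :
    localSpectrum f h W = open Classical in if h = h₀ then ((d : ℝ≥0∞) : WithBot ℝ≥0∞) else ⊥ := by
  unfold localSpectrum hausdorffDim
  split_ifs with h1 h2 h2
  · subst h2
    obtain ⟨t, ht⟩ := hWn
    exact absurd h1 (Set.Nonempty.ne_empty ⟨t, hf t, ht⟩)
  · rfl
  · subst h2
    have : isoHolderSet f h ∩ W = W := inter_eq_right.2 fun t _ => hf t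
    rw [this, Real.dimH_of_nonempty_interior (by rwa [hW.interior_eq]), finrank_euclideanSpace_fin]
  · refine absurd (eq_empty_iff_forall_notMem.2 fun t ht => h2 ?_) h1
    rw [← ht.1, hf t]

/-! ### Application to the Chentsov field. -/

variable {Ω : Type*} [MeasurableSpace Ω] {P : Measure Ω}

theorem IsVariogramField.congr {μ : Measure (UnitSphere d)}
    {X Y : EuclideanSpace ℝ (Fin d) → Ω → ℝ} (hX : IsVariogramField μ X P)
    (h : ∀ t, X t =ᵐ[P] Y t) : IsVariogramField μ Y P where
  gaussian := hX.gaussian.congr h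
  centered t := by rw [← hX.centered t]; exact integral_congr_ae (h t).symm
  cov t t' := by 
    rw [← hX.cov t t', covariance, covariance, integral_congr_ae (h t), integral_congr_ae (h t')]
    refine integral_congr_ae ?_
    filter_upwards [h t, h t'] with ω h1 h2
    rw [h1, h2]

theorem IsChentsovField.isVariogramField {μ : Measure (UnitSphere d)} [IsFiniteMeasure μ]
    (hsymm : IsSymmetricMeasure μ) {B : EuclideanSpace ℝ (Fin d) → Ω → ℝ}
    (hB : IsChentsovField μ B P) : IsVariogramField μ B P := by
  obtain ⟨N, hN, hBN⟩ := hB.exists_whiteNoise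
  exact (hN.isVariogramField hsymm).congr fun t => (hBN t).symm

theorem IsChentsovField.ae_holderExponent_eq [IsProbabilityMeasure P]
    {μ : Measure (UnitSphere d)} [IsFiniteMeasure μ] (hsymm : IsSymmetricMeasure μ) (hμ : μ ≠ 0)
    {B : EuclideanSpace ℝ (Fin d) → Ω → ℝ} (hB : IsChentsovField μ B P) :
    ∀ᵐ ω ∂P, IsLocallyBounded (fun t => B t ω) ∧
      ∀ t : EuclideanSpace ℝ (Fin d), holderExponent (fun s => B s ω) t = 1 / 2 := by
  have hX := hB.isVariogramField hsymm
  obtain ⟨S, hSc, hSd, hsep⟩ := hB.separable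
  have hα0 : ∀ m : ℕ, (0 : ℝ) < 1 / 2 - 1 / (m + 3) := fun m =>
    sub_pos.2 (one_div_lt_one_div_of_lt two_pos (by linarith [Nat.cast_nonneg (α := ℝ) m]))
  have hα1 : ∀ m : ℕ, (1 / 2 - 1 / (m + 3) : ℝ) < 1 / 2 := fun m =>
    sub_lt_self _ (by positivity)
  filter_upwards [hsep, ae_all_iff.2 fun m : ℕ => hX.ae_modulus_le hSc (hα0 m) (hα1 m),
    ae_all_iff.2 fun m : ℕ => hX.ae_not_holder hμ (β := 1 / 2 + 1 / (m + 2))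
      (lt_add_of_pos_right _ (by positivity))] with ω h1 h2 h3
  have hlow : ∀ (t₀ : EuclideanSpace ℝ (Fin d)) (m : ℕ), ∃ C : ℝ, 0 < C ∧
      ∀ᶠ t in 𝓝 t₀, |B t ω - B t₀ ω| ≤ C * ‖t - t₀‖ ^ (1 / 2 - 1 / (m + 3) : ℝ) := by
    intro t₀ m
    refine eventually_abs_sub_le_of_separable (f := fun t => B t ω) hSd h1 (hα0 m) ?_ (h2 m) t₀
    have hr : (1 / 2 : ℝ) ^ (1 / 2 - 1 / (m + 3) : ℝ) < 1 :=
      Real.rpow_lt_one (by norm_num) (by norm_num) (hα0 m)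
    have : 0 < 1 - (1 / 2 : ℝ) ^ (1 / 2 - 1 / (m + 3) : ℝ) := by linarith
    positivity
  exact ⟨isLocallyBounded_of_eventually_le (hα0 0).le fun t₀ => hlow t₀ 0,
    fun t => holderExponent_eq_half (hlow t) fun m C => h3 m t C⟩

end ChentsovField

theorem mainTheorem3 {d : ℕ} (μ : Measure (ChentsovField.UnitSphere d)) [IsFiniteMeasure μ]
    (hsymm : ChentsovField.IsSymmetricMeasure μ) (hμ : μ ≠ 0)
    {Ω : Type*} [MeasurableSpace Ω] (P : Measure Ω) [IsProbabilityMeasure P]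
    (B : EuclideanSpace ℝ (Fin d) → Ω → ℝ) (hB : ChentsovField.IsChentsovField μ B P) :
    ChentsovField.IsHomogeneous B P ∧
    ChentsovField.IsHomogeneousMonoHolder B P ∧
    (∀ᵐ ω ∂P, ChentsovField.IsLocallyBounded (fun t => B t ω) ∧
      ∀ t : EuclideanSpace ℝ (Fin d),
        ChentsovField.holderExponent (fun s => B s ω) t = 1 / 2) := by
  classical
  have h := hB.ae_holderExponent_eq hsymm hμ
  -- The spectrum is `d` at `1/2` and `-∞` elsewhere.
  have hs : ChentsovField.HasSpectrum B P
      fun h => if h = 1 / 2 then ((d : ℝ≥0∞) : WithBot ℝ≥0∞) else ⊥ := by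
    filter_upwards [h] with ω hω
    refine ⟨hω.1, fun h W hW hWn => ?_⟩
    rw [ChentsovField.localSpectrum_eq hω.2 h hW hWn]
  refine ⟨⟨_, hs⟩, ⟨_, hs, 1 / 2, ?_⟩, h⟩
  ext h
  by_cases hh : h = 1 / 2
  · simp only [hh, mem_ofPred_eq, if_true, mem_singleton_iff, iff_true]
    exact WithBot.coe_le_coe.2 (zero_le (a := (d : ℝ≥0∞)))
  · simp only [hh, mem_ofPred_eq, if_false, mem_singleton_iff, iff_false]
    exact not_le.2 (WithBot.bot_lt_coe (0 : ℝ≥0∞))
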